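/- For a real polynomial $P(z)=\sum_{k=0}^{d}a_kz^k$ of degree $d\ge 2$ with all coefficients $a_0,\dots,a_d$ nonzero, put $$q_k(P)=\frac{a_{k-1}^2}{a_{k-2}a_k},\qquad k=2,3,\dots,d.$$ For $n\in\mathbb N=\{1,2,\dots\}$ let $b_{2n}$ be the unique positive root of the equation $1-2\sum_{k=1}^{n}x^{-k^2/2}=0$. (i) Let $n\in\mathbb N$ and let $P$ be a real polynomial of degree $2n$ with all coefficients nonzero. If $|q_k(P)|\ge b_{2n}$ for all $k=2,3,\dots,2n$, then all complex zeros of $P$ are real. (ii) For every $n\in\mathbb N$ and every $\varepsilon>0$ there exists a real polynomial $P$ of degree $2n$ with all coefficients nonzero such that $|q_k(P)|>b_{2n}-\varepsilon$ for all $k=2,3,\dots,2n$ and $P$ has nonreal zeros. (iii) Let $n\in\mathbb N$ and let $P$ be a real polynomial of degree $2n+1$ with all coefficients nonzero. If $|q_k(P)|\ge b_{2n+2}$ for all $k=2,3,\dots,2n+1$, then all complex zeros of $P$ are real. (iv) For every $n\in\mathbb N$ and every $\varepsilon>0$ there exists a real polynomial $P$ of degree $2n+1$ with all coefficients nonzero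 such that $|q_k(P)|>b_{2n}-\varepsilon$ for all $k=2,3,\dots,2n+1$ and $P$ has nonreal zeros. (v) Let $P$ be a real polynomial of degree $3$ with all coefficients nonzero. If $|q_k(P)|\ge\sqrt{9+6\sqrt3}$ for $k=2,3$, then all complex zeros of $P$ are real. (vi) For every $\varepsilon>0$ there exists a real polynomial $P$ of degree $3$ with all coefficients nonzero such that $|q_k(P)|>\sqrt{9+6\sqrt3}-\varepsilon$ for $k=2,3$ and $P$ has nonreal zeros. -/

import Mathlib

open Polynomial

noncomputable section

/-- The second quotient `q_k(P) = a_{k-1}^2 / (a_{k-2} a_k)` of the coefficients of `P`.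
It is meant for `2 ≤ k ≤ deg P`. -/
def secondQuotient (P : ℝ[X]) (k : ℕ) : ℝ :=
  P.coeff (k - 1) ^ 2 / (P.coeff (k - 2) * P.coeff k)

/-- `x` is a positive root of the equation `1 - 2 ∑_{k=1}^n x^{-k²/2} = 0`. -/
def IsThetaRoot (n : ℕ) (x : ℝ) : Prop :=
  0 < x ∧ 1 - 2 * ∑ k ∈ Finset.Icc 1 n, x ^ (-(k : ℝ) ^ 2 / 2) = 0

/-- The number `b_{2n}`: the positive root of `1 - 2 ∑_{k=1}^n x^{-k²/2} = 0`. It exists and is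
unique for every `n ≥ 1` (see `existsUnique_isThetaRoot`); the argument is half of the index. -/
def bEven (n : ℕ) : ℝ := Classical.epsilon (IsThetaRoot n)

/-- All complex zeros of the real polynomial `P` are real. -/
def AllZerosReal (P : ℝ[X]) : Prop := ∀ z : ℂ, aeval z P = 0 → z.im = 0

/-- The real polynomial `P` has a nonreal complex zero. -/
def HasNonrealZero (P : ℝ[X]) : Prop := ∃ z : ℂ, aeval z P = 0 ∧ z.im ≠ 0

/-- `P` has degree `d` and all its coefficients `a_0, …, a_d` are nonzero. -/
def HasDegreeAndNonzeroCoeffs (P : ℝ[X]) (d : ℕ) : Prop :=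
  P.natDegree = d ∧ ∀ k ≤ d, P.coeff k ≠ 0

theorem existsUnique_isThetaRoot (n : ℕ) (hn : 1 ≤ n) : ∃! x : ℝ, IsThetaRoot n x := by
  have hanti : ∀ x y : ℝ, 0 < x → x < y →
      ∑ k ∈ Finset.Icc 1 n, y ^ (-(k : ℝ) ^ 2 / 2) <
        ∑ k ∈ Finset.Icc 1 n, x ^ (-(k : ℝ) ^ 2 / 2) := by
    intro x y hx hxy
    refine Finset.sum_lt_sum_of_nonempty ⟨1, by simp [hn]⟩ fun k hk => ?_
    have hk1 : (1 : ℝ) ≤ k := by exact_mod_cast (Finset.mem_Icc.1 hk).1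
    exact Real.rpow_lt_rpow_of_neg hx hxy (by nlinarith)
  have hn1 : (1 : ℝ) ≤ n := by exact_mod_cast hn
  have hcont : ContinuousOn
      (fun x : ℝ => 1 - 2 * ∑ k ∈ Finset.Icc 1 n, x ^ (-(k : ℝ) ^ 2 / 2))
      (Set.Icc 1 ((2 * (n : ℝ)) ^ 2)) := by
    refine continuousOn_const.sub (continuousOn_const.mul (continuousOn_finsetSum _ fun k _ => ?_))
    refine continuousOn_id.rpow_const fun x hx => Or.inl ?_
    have := hx.1
    simp only [id]
    linarith
  have hle : (1 : ℝ) ≤ (2 * (n : ℝ)) ^ 2 := by nlinarith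
  have hmem : (0 : ℝ) ∈ Set.Icc
      (1 - 2 * ∑ k ∈ Finset.Icc 1 n, (1 : ℝ) ^ (-(k : ℝ) ^ 2 / 2))
      (1 - 2 * ∑ k ∈ Finset.Icc 1 n, ((2 * (n : ℝ)) ^ 2) ^ (-(k : ℝ) ^ 2 / 2)) := by
    constructor
    · simp only [Real.one_rpow, Finset.sum_const, Nat.card_Icc, Nat.add_sub_cancel, nsmul_eq_mul,
        mul_one]
      linarith
    · have hb : ∑ k ∈ Finset.Icc 1 n, ((2 * (n : ℝ)) ^ 2) ^ (-(k : ℝ) ^ 2 / 2) ≤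
          ∑ _k ∈ Finset.Icc 1 n, (2 * (n : ℝ))⁻¹ := by
        refine Finset.sum_le_sum fun k hk => ?_
        have hk1 : (1 : ℝ) ≤ k := by exact_mod_cast (Finset.mem_Icc.1 hk).1
        have h2 : (((2 * (n : ℝ)) ^ 2) : ℝ) ^ (-(1 : ℝ) / 2) = (2 * (n : ℝ))⁻¹ := by
          rw [← Real.rpow_natCast, ← Real.rpow_mul (by positivity)]
          norm_num
          rw [Real.rpow_neg_one, mul_inv]
          ring
        rw [← h2]
        exact Real.rpow_le_rpow_of_exponent_le hle (by nlinarith)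
      simp only [Finset.sum_const, Nat.card_Icc, Nat.add_sub_cancel, nsmul_eq_mul] at hb
      have : (n : ℝ) * (2 * (n : ℝ))⁻¹ = 1 / 2 := by field_simp
      linarith
  obtain ⟨x, hx, hx0⟩ := intermediate_value_Icc hle hcont hmem
  refine ⟨x, ⟨by linarith [hx.1], hx0⟩, ?_⟩
  rintro y ⟨hy, hy0⟩
  simp only at hx0
  rcases lt_trichotomy y x with h | h | h
  · have := hanti y x hy h
    linarith
  · exact h
  · have := hanti x y (by linarith [hx.1]) h
    linarith

theorem bEven_spec (n : ℕ) (hn : 1 ≤ n) : IsThetaRoot n (bEven n) :=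
  Classical.epsilon_spec (existsUnique_isThetaRoot n hn).exists

end

/-! ### Real-rooted polynomials -/

/-! Real-rootedness: with `t = b^(-1/2)`, the bound `|q_k| ≥ b` reads `|a_k a_{k+2}| ≤ t² a_{k+1}²`.
At `x = √|a_{j-1}/a_{j+1}|` the terms `w_k = |a_k| x^k` then decay like a Gaussian, `w_{j±m} ≤
t^{m²} w_j`, so the other terms sum to at most `(S(j) + S(d-j)) w_j`, where `S(m) = ∑_{k=1}^m
t^{k²}` (`exists_dominant_interior`). For `d ≤ 2n` this factor is at most `2 S(n)`, which is `1` at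
`b = b_{2n}`. If it is below `1`, every monomial dominates somewhere, and sign changes give `d` real
zeros with distinct moduli (`splits_of_dominant`). Equality is reached as a limit
(`allZerosReal_of_coeff_mul_coeff_le`).

Sharpness: take coefficients `±s^{k²}`, positive only at `k = n`, with `s` slightly above
`b_{2n}^(-1/2)`. AM-GM on the pairs `n ± m` makes the polynomial negative on the positive axis
(`eval_gaussianScale_peakSign_neg`), although its coefficients have both signs, which is impossible
with real zeros only.

Degree 3: with `u = 1/q_2`, `v = 1/q_3`, the discriminant is `(a_1 a_2)² (1 - 4u - 4v + 18uv -
27u²v²)`. The worst corners of the square `|u|, |v| ≤ t` are `u = -v = ±t`, giving `1 - 18t² -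
27t⁴`, which vanishes at `1/t² = 9 + 6√3`. -/

theorem hasNonrealZero_of_not_allZerosReal {P : ℝ[X]} (h : ¬ AllZerosReal P) :
    HasNonrealZero P := by
  simpa [AllZerosReal, HasNonrealZero] using h

theorem AllZerosReal.splits {P : ℝ[X]} (h : AllZerosReal P) : P.Splits := by
  refine Splits.of_splits_map (algebraMap ℝ ℂ) (IsAlgClosed.splits _) fun z hz => ?_
  have hz0 : aeval z P = 0 := by
    rw [aeval_def, ← eval_map]
    exact (mem_roots'.1 hz).2
  exact ⟨z.re, Complex.ext (by simp) (by simp [h z hz0])⟩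

/-- Each real zero `r` satisfies `|z - r| ≥ |Im z|`. This quantitative bound survives limits of
real-rooted polynomials. -/
theorem leadingCoeff_mul_abs_im_pow_le_norm_aeval {P : ℝ[X]} (hP : P.Splits) (z : ℂ) :
    |P.leadingCoeff| * |z.im| ^ P.natDegree ≤ ‖aeval z P‖ := by
  have key : ∀ s : Multiset ℝ,
      |z.im| ^ s.card ≤ ‖aeval z (s.map fun x => X - C x).prod‖ := by
    intro s
    induction s using Multiset.induction with
    | empty => simp
    | cons r s ih =>
      rw [Multiset.map_cons, Multiset.prod_cons, map_mul, norm_mul, Multiset.card_cons, pow_succ']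
      refine mul_le_mul ?_ ih (by positivity) (norm_nonneg _)
      simpa using Complex.abs_im_le_norm (z - r)
  conv_rhs => rw [hP.eq_prod_roots]
  rw [map_mul, norm_mul, ← splits_iff_card_roots.1 hP]
  simp only [aeval_C, Complex.coe_algebraMap, Complex.norm_real, Real.norm_eq_abs]
  exact mul_le_mul_of_nonneg_left (key _) (abs_nonneg _)

theorem coeff_prod_X_sub_C_nonneg (s : Multiset ℝ) (hs : ∀ r ∈ s, r ≤ 0) (k : ℕ) :
    0 ≤ (s.map fun x => X - C x).prod.coeff k := by
  induction s using Multiset.induction generalizing k with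
  | empty => simp only [Multiset.map_zero, Multiset.prod_zero, coeff_one]; split_ifs <;> simp
  | cons r s ih =>
    have ih' := ih fun x hx => hs x (Multiset.mem_cons_of_mem hx)
    have hr := hs r (Multiset.mem_cons_self r s)
    rw [Multiset.map_cons, Multiset.prod_cons, sub_mul, coeff_sub, coeff_C_mul]
    have h1 : 0 ≤ (X * (s.map fun x => X - C x).prod).coeff k := by
      cases k with
      | zero => simp
      | succ k => rw [coeff_X_mul]; exact ih' k
    nlinarith [ih' k]

/-- A polynomial without positive zeros whose coefficients do not all have the sign of the leading
one has a nonreal zero. -/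
theorem hasNonrealZero_of_forall_pos_eval_ne_zero {P : ℝ[X]} {k : ℕ}
    (hpos : ∀ x : ℝ, 0 < x → P.eval x ≠ 0) (hk : P.leadingCoeff * P.coeff k < 0) :
    HasNonrealZero P := by
  refine hasNonrealZero_of_not_allZerosReal fun h => hk.not_ge ?_
  have hc : P.coeff k = P.leadingCoeff * (P.roots.map fun x => X - C x).prod.coeff k := by
    conv_lhs => rw [h.splits.eq_prod_roots]
    rw [coeff_C_mul]
  rw [hc, ← mul_assoc]
  refine mul_nonneg (mul_self_nonneg _) (coeff_prod_X_sub_C_nonneg _ (fun r hr => ?_) k)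
  by_contra! hr0
  exact hpos r hr0 (mem_roots'.1 hr).2

/-! ### Dominant terms -/

theorem eval_mul_dominant_pos {P : ℝ[X]} {j : ℕ} {x y : ℝ} (hj : j ≤ P.natDegree) (hxy : |y| = x)
    (hdom : ∑ k ∈ (Finset.range (P.natDegree + 1)).erase j, |P.coeff k| * x ^ k <
      |P.coeff j| * x ^ j) : 0 < P.eval y * (P.coeff j * y ^ j) := by
  have hmem : j ∈ Finset.range (P.natDegree + 1) := by simp; omega
  have hsum := Finset.add_sum_erase (Finset.range (P.natDegree + 1))
    (fun k => P.coeff k * y ^ k) hmem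
  rw [← eval_eq_sum_range] at hsum
  have hle : |∑ k ∈ (Finset.range (P.natDegree + 1)).erase j, P.coeff k * y ^ k| <
      |P.coeff j * y ^ j| := by
    refine (Finset.abs_sum_le_sum_abs _ _).trans_lt ?_
    simpa [abs_mul, abs_pow, hxy] using hdom
  rw [← hsum]
  set u := P.coeff j * y ^ j
  set v := ∑ k ∈ (Finset.range (P.natDegree + 1)).erase j, P.coeff k * y ^ k
  have h1 : |v| * |u| < |u| * |u| := mul_lt_mul_of_pos_right hle ((abs_nonneg _).trans_lt hle)
  have h2 := neg_abs_le (v * u)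
  rw [abs_mul] at h2
  rw [abs_mul_abs_self] at h1
  nlinarith

theorem exists_root_of_eval_mul_eval_neg {P : ℝ[X]} {a b : ℝ} (hab : a ≤ b) (s : ℝ)
    (h : P.eval (s * a) * P.eval (s * b) < 0) :
    ∃ y, a < y ∧ y < b ∧ P.eval (s * y) = 0 := by
  have hc : ContinuousOn (fun y => P.eval (s * y)) (Set.Icc a b) := by fun_prop
  rcases mul_neg_iff.1 h with h | h
  · obtain ⟨y, hy, hy0⟩ := intermediate_value_Ioo' hab hc ⟨h.2, h.1⟩
    exact ⟨y, hy.1, hy.2, hy0⟩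
  · obtain ⟨y, hy, hy0⟩ := intermediate_value_Ioo hab hc ⟨h.1, h.2⟩
    exact ⟨y, hy.1, hy.2, hy0⟩

theorem splits_of_dominant {P : ℝ[X]} (x : ℕ → ℝ) (hx : ∀ j ≤ P.natDegree, 0 ≤ x j)
    (hP : ∀ j ≤ P.natDegree, P.coeff j ≠ 0)
    (hdom : ∀ j ≤ P.natDegree, ∑ k ∈ (Finset.range (P.natDegree + 1)).erase j,
      |P.coeff k| * x j ^ k < |P.coeff j| * x j ^ j) : P.Splits := by
  set d := P.natDegree with hd
  have hsingle : ∀ j ≤ d, ∀ k ≤ d, k ≠ j →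
      |P.coeff k| * x j ^ k < |P.coeff j| * x j ^ j := fun j hj k hk hkj =>
    (Finset.single_le_sum (f := fun k => |P.coeff k| * x j ^ k)
      (fun i _ => mul_nonneg (abs_nonneg _) (pow_nonneg (hx j hj) _))
      (Finset.mem_erase.2 ⟨hkj, by simp; omega⟩)).trans_lt (hdom j hj)
  -- Comparing terms `j` and `j + 1` at both points gives `|a_{j+1}| x_j < |a_j| < |a_{j+1}|
  -- x_{j+1}`.
  have hstep : ∀ j < d, x j < x (j + 1) := by
    intro j hj
    have h1 := hsingle j hj.le (j + 1) hj (by omega)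
    have h2 := hsingle (j + 1) hj j hj.le (by omega)
    rw [pow_succ, ← mul_assoc, mul_right_comm] at h1 h2
    have h3 : |P.coeff (j + 1)| * x j < |P.coeff j| :=
      lt_of_mul_lt_mul_right h1 (pow_nonneg (hx j hj.le) _)
    have h4 : |P.coeff j| < |P.coeff (j + 1)| * x (j + 1) :=
      lt_of_mul_lt_mul_right h2 (pow_nonneg (hx (j + 1) hj) _)
    exact lt_of_mul_lt_mul_left (h3.trans h4) (abs_nonneg _)
  have hroot : ∀ j, ∃ r : ℝ, j < d → x j < |r| ∧ |r| < x (j + 1) ∧ P.eval r = 0 := by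
    intro j
    by_cases hj : j < d
    swap
    · exact ⟨0, fun h => absurd h hj⟩
    -- The half-line is chosen so that the monomials dominating at `s * x j` and `s * x (j + 1)`
    -- have opposite signs.
    obtain ⟨s, hs, hsneg⟩ : ∃ s : ℝ, |s| = 1 ∧ P.coeff j * P.coeff (j + 1) * s < 0 := by
      rcases lt_or_gt_of_ne (mul_ne_zero (hP j hj.le) (hP (j + 1) hj)) with h | h
      · exact ⟨1, by simp, by linarith⟩
      · exact ⟨-1, by simp, by linarith⟩
    have h1 := eval_mul_dominant_pos (P := P) (y := s * x j) hj.le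
      (by rw [abs_mul, hs, one_mul, abs_of_nonneg (hx j hj.le)]) (hdom j hj.le)
    have h2 := eval_mul_dominant_pos (P := P) (y := s * x (j + 1)) hj
      (by rw [abs_mul, hs, one_mul, abs_of_nonneg (hx (j + 1) hj)]) (hdom (j + 1) hj)
    have hs2 : s ^ 2 = 1 := by rw [← sq_abs, hs, one_pow]
    have h3 := mul_pos h1 h2
    have h4 : P.eval (s * x j) * (P.coeff j * (s * x j) ^ j) *
        (P.eval (s * x (j + 1)) * (P.coeff (j + 1) * (s * x (j + 1)) ^ (j + 1))) =
        -(P.eval (s * x j) * P.eval (s * x (j + 1))) *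
          (-(P.coeff j * P.coeff (j + 1) * s) * (x j ^ j * x (j + 1) ^ (j + 1))) := by
      have : (s * x j) ^ j * (s * x (j + 1)) ^ (j + 1) =
          s * (x j ^ j * x (j + 1) ^ (j + 1)) := by
        rw [mul_pow, mul_pow, pow_succ s]
        have : s ^ j * s ^ j = 1 := by rw [← pow_add, ← two_mul, pow_mul, hs2, one_pow]
        linear_combination x j ^ j * s * x (j + 1) ^ (j + 1) * this
      linear_combination P.eval (s * x j) * P.coeff j * P.eval (s * x (j + 1)) *
        P.coeff (j + 1) * this
    rw [h4] at h3
    have h5 : 0 ≤ -(P.coeff j * P.coeff (j + 1) * s) * (x j ^ j * x (j + 1) ^ (j + 1)) :=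
      mul_nonneg (by linarith) (mul_nonneg (pow_nonneg (hx j hj.le) _) (pow_nonneg (hx _ hj) _))
    have h6 := pos_of_mul_pos_left h3 h5
    obtain ⟨y, hy1, hy2, hy⟩ := exists_root_of_eval_mul_eval_neg (hstep j hj).le s
      (by linarith : P.eval (s * x j) * P.eval (s * x (j + 1)) < 0)
    refine ⟨s * y, fun _ => ?_⟩
    rw [abs_mul, hs, one_mul, abs_of_pos ((hx j hj.le).trans_lt hy1)]
    exact ⟨hy1, hy2, hy⟩
  choose r hr using hroot
  have hmono : ∀ i j, i < j → j ≤ d → x i < x j := by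
    intro i j hij
    induction j, hij using Nat.le_induction with
    | base => exact fun h => hstep i h
    | succ j hij ih => exact fun h => (ih (by omega)).trans (hstep j h)
  have hlt : ∀ i j, i < j → j < d → |r i| < |r j| := by
    intro i j hij hj
    have h1 := (hr i (hij.trans hj)).2.1
    have h2 := (hr j hj).1
    rcases (Nat.succ_le_of_lt hij).eq_or_lt with h | h
    · rw [← h] at h2 ⊢; exact h1.trans h2
    · exact h1.trans ((hmono _ _ h hj.le).trans h2)
  have hinj : Set.InjOn r (Finset.range d : Set ℕ) := by
    intro i hi j hj hij
    simp only [Finset.coe_range, Set.mem_Iio] at hi hj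
    rcases lt_trichotomy i j with h | h | h
    · exact absurd (congrArg abs hij) (hlt i j h hj).ne
    · exact h
    · exact absurd (congrArg abs hij) (hlt j i h hi).ne'
  have hP0 : P ≠ 0 := by
    rintro rfl
    exact hP 0 (Nat.zero_le _) (by simp)
  rw [splits_iff_card_roots]
  refine le_antisymm (card_roots' P) ?_
  calc d = ((Finset.range d).image r).card := by
        rw [Finset.card_image_of_injOn hinj, Finset.card_range]
    _ ≤ P.roots.toFinset.card := by
        refine Finset.card_le_card fun y hy => ?_
        obtain ⟨j, hj, rfl⟩ := Finset.mem_image.1 hy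
        rw [Multiset.mem_toFinset, mem_roots hP0]
        exact (hr j (Finset.mem_range.1 hj)).2.2
    _ ≤ P.roots.card := Multiset.toFinset_card_le _

/-! ### Coefficients with large second quotients -/

/-- Successive ratios gain a factor `t²` each, so `u (m + 1) / u m ≤ t^(2m+1)`, and `1 + 3 + ⋯ +
(2m-1) = m²`. -/
theorem le_pow_sq_mul_of_mul_le {u : ℕ → ℝ} {N : ℕ} {t : ℝ} (ht : 0 ≤ t)
    (hu : ∀ k ≤ N, 0 < u k) (h1 : 1 ≤ N → u 1 ≤ t * u 0)
    (h : ∀ k, k + 2 ≤ N → u k * u (k + 2) ≤ t ^ 2 * u (k + 1) ^ 2) :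
    ∀ m ≤ N, u m ≤ t ^ (m ^ 2) * u 0 := by
  have hstep : ∀ m, m + 1 ≤ N → u (m + 1) ≤ t ^ (2 * m + 1) * u m := by
    intro m
    induction m with
    | zero => simpa using h1
    | succ m ih =>
      intro hm
      have h0 := hu m (by omega)
      refine le_of_mul_le_mul_left ?_ h0
      calc u m * u (m + 1 + 1) ≤ t ^ 2 * u (m + 1) ^ 2 := h m hm
        _ = t ^ 2 * u (m + 1) * u (m + 1) := by ring
        _ ≤ t ^ 2 * u (m + 1) * (t ^ (2 * m + 1) * u m) :=
          mul_le_mul_of_nonneg_left (ih (by omega))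
            (mul_nonneg (by positivity) (hu (m + 1) (by omega)).le)
        _ = u m * (t ^ (2 * (m + 1) + 1) * u (m + 1)) := by ring
  intro m
  induction m with
  | zero => simp
  | succ m ih =>
    intro hm
    calc u (m + 1) ≤ t ^ (2 * m + 1) * u m := hstep m hm
      _ ≤ t ^ (2 * m + 1) * (t ^ (m ^ 2) * u 0) :=
        mul_le_mul_of_nonneg_left (ih (by omega)) (by positivity)
      _ = t ^ ((m + 1) ^ 2) * u 0 := by rw [← mul_assoc, ← pow_add]; congr 2; ring

/-- The partial sum `∑_{k=1}^m t^{k²}` of the theta series. -/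
noncomputable def thetaSum (t : ℝ) (m : ℕ) : ℝ := ∑ k ∈ Finset.range m, t ^ ((k + 1) ^ 2)

theorem thetaSum_succ (t : ℝ) (m : ℕ) :
    thetaSum t (m + 1) = thetaSum t m + t ^ ((m + 1) ^ 2) :=
  Finset.sum_range_succ _ _

theorem thetaSum_mono {t : ℝ} (ht : 0 ≤ t) : Monotone (thetaSum t) :=
  monotone_nat_of_le_succ fun m => by rw [thetaSum_succ]; linarith [pow_nonneg ht ((m + 1) ^ 2)]

theorem thetaSum_lt {s t : ℝ} (hs : 0 ≤ s) (hst : s < t) {m : ℕ} (hm : 1 ≤ m) :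
    thetaSum s m < thetaSum t m :=
  Finset.sum_lt_sum_of_nonempty ⟨0, by simp; omega⟩ fun _ _ => pow_lt_pow_left₀ hst hs (by simp)

/-- Spreading the two lengths apart by one more step trades `t^((n-m)²)` for the smaller
`t^((n+m+1)²)`. -/
theorem thetaSum_sub_add_thetaSum_add_le {t : ℝ} (ht : 0 ≤ t) (ht1 : t ≤ 1) (n m : ℕ)
    (hm : m ≤ n) : thetaSum t (n - m) + thetaSum t (n + m) ≤ 2 * thetaSum t n := by
  induction m with
  | zero => simp [two_mul]
  | succ m ih =>
    have h1 : n - m = n - (m + 1) + 1 := by omega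
    have h2 := ih (by omega)
    rw [h1, thetaSum_succ] at h2
    rw [← add_assoc, thetaSum_succ]
    have h3 : t ^ ((n + m + 1) ^ 2) ≤ t ^ ((n - (m + 1) + 1) ^ 2) :=
      pow_le_pow_of_le_one ht ht1 (Nat.pow_le_pow_left (by omega) 2)
    linarith

theorem thetaSum_add_thetaSum_le {t : ℝ} (ht : 0 ≤ t) (ht1 : t ≤ 1) {n j : ℕ} (hj : j ≤ 2 * n) :
    thetaSum t j + thetaSum t (2 * n - j) ≤ 2 * thetaSum t n := by
  rcases le_total j n with h | h
  · have := thetaSum_sub_add_thetaSum_add_le ht ht1 n (n - j) (by omega)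
    rwa [show n - (n - j) = j by omega, show n + (n - j) = 2 * n - j by omega] at this
  · have := thetaSum_sub_add_thetaSum_add_le ht ht1 n (j - n) (by omega)
    rw [show n - (j - n) = 2 * n - j by omega, show n + (j - n) = j by omega] at this
    linarith

theorem sum_erase_range_eq (w : ℕ → ℝ) {d j : ℕ} (hj : j ≤ d) :
    ∑ k ∈ (Finset.range (d + 1)).erase j, w k =
      ∑ m ∈ Finset.range j, w (j - (m + 1)) + ∑ m ∈ Finset.range (d - j), w (j + (m + 1)) := by
  have h1 := Finset.add_sum_erase (Finset.range (d + 1)) w (a := j) (by simp; omega)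
  rw [show d + 1 = j + 1 + (d - j) by omega, Finset.sum_range_add, Finset.sum_range_succ,
    ← Finset.sum_range_reflect w j] at h1
  rw [show d + 1 = j + 1 + (d - j) by omega]
  have h2 : ∑ m ∈ Finset.range (d - j), w (j + 1 + m) =
      ∑ m ∈ Finset.range (d - j), w (j + (m + 1)) :=
    Finset.sum_congr rfl fun m _ => by rw [add_assoc, add_comm 1 m]
  have h3 : ∑ m ∈ Finset.range j, w (j - 1 - m) = ∑ m ∈ Finset.range j, w (j - (m + 1)) :=
    Finset.sum_congr rfl fun m _ => by rw [Nat.sub_sub, add_comm 1 m]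
  linarith

theorem exists_dominant_interior {A : ℕ → ℝ} {d j : ℕ} {t : ℝ} (ht : 0 ≤ t)
    (hA : ∀ k ≤ d, 0 < A k)
    (hlc : ∀ k, k + 2 ≤ d → A k * A (k + 2) ≤ t ^ 2 * A (k + 1) ^ 2)
    (hj : 1 ≤ j) (hjd : j < d) (hS : thetaSum t j + thetaSum t (d - j) < 1) :
    ∃ x, 0 ≤ x ∧ ∑ k ∈ (Finset.range (d + 1)).erase j, A k * x ^ k < A j * x ^ j := by
  have hm := hA (j - 1) (by omega)
  have hp := hA (j + 1) (by omega)
  -- This point equalizes the terms `j - 1` and `j + 1`, so log-concavity bounds both by `t * w j`.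
  set x := √(A (j - 1) / A (j + 1)) with hxdef
  have hx : 0 < x := Real.sqrt_pos.2 (div_pos hm hp)
  have hx2 : A (j + 1) * x ^ 2 = A (j - 1) := by
    rw [hxdef, Real.sq_sqrt (div_pos hm hp).le, mul_div_cancel₀ _ hp.ne']
  set w : ℕ → ℝ := fun k => A k * x ^ k with hw
  have hwpos : ∀ k ≤ d, 0 < w k := fun k hk => mul_pos (hA k hk) (pow_pos hx _)
  have hwlc : ∀ k, k + 2 ≤ d → w k * w (k + 2) ≤ t ^ 2 * w (k + 1) ^ 2 := fun k hk =>
    calc w k * w (k + 2) = A k * A (k + 2) * (x ^ (k + 1)) ^ 2 := by simp only [hw]; ring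
      _ ≤ t ^ 2 * A (k + 1) ^ 2 * (x ^ (k + 1)) ^ 2 :=
        mul_le_mul_of_nonneg_right (hlc k hk) (by positivity)
      _ = t ^ 2 * w (k + 1) ^ 2 := by simp only [hw]; ring
  have hweq : w (j + 1) = w (j - 1) := by
    simp only [hw]
    rw [← hx2, show j + 1 = (j - 1) + 2 by omega]
    ring
  have hwle : w (j + 1) ≤ t * w j := by
    have h := hwlc (j - 1) (by omega)
    rw [show j - 1 + 2 = j + 1 by omega, show j - 1 + 1 = j by omega, ← hweq, ← mul_pow,
      ← pow_two] at h
    exact le_of_sq_le_sq h (mul_nonneg ht (hwpos j hjd.le).le)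
  have hup := le_pow_sq_mul_of_mul_le (u := fun m => w (j + m)) (N := d - j) ht
    (fun k hk => hwpos _ (by omega)) (fun _ => hwle) (fun k hk => hwlc (j + k) (by omega))
  have hdown := le_pow_sq_mul_of_mul_le (u := fun m => w (j - m)) (N := j) ht
    (fun k hk => hwpos _ (by omega)) (fun _ => by simpa [← hweq] using hwle) (fun k hk => by
      have h := hwlc (j - (k + 2)) (by omega)
      rw [show j - (k + 2) + 2 = j - k by omega, show j - (k + 2) + 1 = j - (k + 1) by omega,
        mul_comm] at h
      exact h)
  refine ⟨x, hx.le, ?_⟩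
  change ∑ k ∈ (Finset.range (d + 1)).erase j, w k < w j
  rw [sum_erase_range_eq w hjd.le]
  have h1 : ∑ m ∈ Finset.range j, w (j - (m + 1)) ≤ thetaSum t j * w j := by
    rw [thetaSum, Finset.sum_mul]
    exact Finset.sum_le_sum fun m hm => hdown (m + 1) (Finset.mem_range.1 hm)
  have h2 : ∑ m ∈ Finset.range (d - j), w (j + (m + 1)) ≤ thetaSum t (d - j) * w j := by
    rw [thetaSum, Finset.sum_mul]
    exact Finset.sum_le_sum fun m hm => hup (m + 1) (Finset.mem_range.1 hm)
  nlinarith [hwpos j hjd.le]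

theorem exists_dominant_leading {A : ℕ → ℝ} {d : ℕ} (hA : ∀ k ≤ d, 0 < A k) :
    ∃ x, 0 ≤ x ∧ ∑ k ∈ (Finset.range (d + 1)).erase d, A k * x ^ k < A d * x ^ d := by
  have hd := hA d le_rfl
  have hsum : 0 ≤ ∑ k ∈ Finset.range d, A k :=
    Finset.sum_nonneg fun k hk => (hA k (Finset.mem_range.1 hk).le).le
  have hx : 1 ≤ 1 + (∑ k ∈ Finset.range d, A k) / A d := by
    linarith [div_nonneg hsum hd.le]
  refine ⟨1 + (∑ k ∈ Finset.range d, A k) / A d, by linarith, ?_⟩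
  have hxeq : A d * (1 + (∑ k ∈ Finset.range d, A k) / A d) = A d + ∑ k ∈ Finset.range d, A k := by
    field_simp
  set x := 1 + (∑ k ∈ Finset.range d, A k) / A d
  rw [Finset.range_add_one, Finset.erase_insert (by simp)]
  cases d with
  | zero => simpa using hd
  | succ d =>
    calc ∑ k ∈ Finset.range (d + 1), A k * x ^ k ≤ ∑ k ∈ Finset.range (d + 1), A k * x ^ d := by
          refine Finset.sum_le_sum fun k hk => ?_
          have hk' := Finset.mem_range.1 hk
          exact mul_le_mul_of_nonneg_left (pow_le_pow_right₀ hx (by omega)) (hA k (by omega)).le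
      _ = (∑ k ∈ Finset.range (d + 1), A k) * x ^ d := by rw [Finset.sum_mul]
      _ < (A (d + 1) * x) * x ^ d :=
          mul_lt_mul_of_pos_right (by linarith) (pow_pos (by linarith) _)
      _ = A (d + 1) * x ^ (d + 1) := by ring

theorem splits_of_coeff_mul_coeff_le {P : ℝ[X]} {t : ℝ} (ht : 0 ≤ t)
    (hP : ∀ k ≤ P.natDegree, P.coeff k ≠ 0)
    (hlc : ∀ k, k + 2 ≤ P.natDegree →
      |P.coeff k| * |P.coeff (k + 2)| ≤ t ^ 2 * |P.coeff (k + 1)| ^ 2)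
    (hS : ∀ j, 1 ≤ j → j < P.natDegree → thetaSum t j + thetaSum t (P.natDegree - j) < 1) :
    P.Splits := by
  have hA : ∀ k ≤ P.natDegree, 0 < |P.coeff k| := fun k hk => abs_pos.2 (hP k hk)
  have hex : ∀ j, ∃ x, j ≤ P.natDegree → 0 ≤ x ∧
      ∑ k ∈ (Finset.range (P.natDegree + 1)).erase j, |P.coeff k| * x ^ k <
        |P.coeff j| * x ^ j := by
    intro j
    rcases Nat.eq_zero_or_pos j with rfl | hj
    -- At `x = 0` only the constant term survives, since `0 ^ 0 = 1`.
    · refine ⟨0, fun _ => ⟨le_rfl, ?_⟩⟩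
      rw [Finset.sum_eq_zero fun k hk => by simp [(Finset.mem_erase.1 hk).1]]
      simpa using hP 0 (Nat.zero_le _)
    rcases lt_trichotomy j P.natDegree with h | rfl | h
    · obtain ⟨x, hx⟩ := exists_dominant_interior ht hA hlc hj h (hS j hj h)
      exact ⟨x, fun _ => hx⟩
    · obtain ⟨x, hx⟩ := exists_dominant_leading hA
      exact ⟨x, fun _ => hx⟩
    · exact ⟨0, fun h' => absurd h' (by omega)⟩
  choose x hx using hex
  exact splits_of_dominant x (fun j hj => (hx j hj).1) hP fun j hj => (hx j hj).2

/-! ### The boundary case -/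

/-- The polynomial with coefficients `a_k θ^{k²}` for `k ≤ d`. -/
noncomputable def gaussianScale (a : ℕ → ℝ) (d : ℕ) (θ : ℝ) : ℝ[X] :=
  ∑ k ∈ Finset.range (d + 1), C (a k * θ ^ (k ^ 2)) * X ^ k

theorem coeff_gaussianScale (a : ℕ → ℝ) (d : ℕ) (θ : ℝ) {k : ℕ} (hk : k ≤ d) :
    (gaussianScale a d θ).coeff k = a k * θ ^ (k ^ 2) := by
  simp only [gaussianScale, finsetSum_coeff, coeff_C_mul_X_pow]
  rw [Finset.sum_eq_single k (fun b _ hb => if_neg hb.symm) (fun h => by simp at h; omega),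
    if_pos rfl]

theorem natDegree_gaussianScale {a : ℕ → ℝ} {d : ℕ} {θ : ℝ} (ha : a d ≠ 0) (hθ : θ ≠ 0) :
    (gaussianScale a d θ).natDegree = d := by
  refine le_antisymm (natDegree_sum_le_of_forall_le _ _ fun k hk => ?_) (le_natDegree_of_ne_zero ?_)
  · exact (natDegree_C_mul_X_pow_le _ _).trans (by simp at hk; omega)
  · rw [coeff_gaussianScale a d θ le_rfl]
    exact mul_ne_zero ha (pow_ne_zero _ hθ)

/-- Since `k² + (k+2)² - 2(k+1)² = 2`, multiplying `a_k` by `θ^(k²)` replaces `t` by `θ t`, making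
the inequality strict for `θ < 1`. The lower bound on the modulus at a supposed nonreal zero then
passes to `θ → 1` and contradicts `P(z) = 0`. -/
theorem allZerosReal_of_coeff_mul_coeff_le {P : ℝ[X]} {t : ℝ} (ht : 0 < t)
    (hP : ∀ k ≤ P.natDegree, P.coeff k ≠ 0)
    (hlc : ∀ k, k + 2 ≤ P.natDegree →
      |P.coeff k| * |P.coeff (k + 2)| ≤ t ^ 2 * |P.coeff (k + 1)| ^ 2)
    (hS : ∀ j, 1 ≤ j → j < P.natDegree → thetaSum t j + thetaSum t (P.natDegree - j) ≤ 1) :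
    AllZerosReal P := by
  intro z hz
  by_contra him
  set d := P.natDegree with hd
  have hbound : ∀ θ : ℝ, 0 < θ → θ < 1 →
      |P.coeff d| * θ ^ (d ^ 2) * |z.im| ^ d ≤ ‖aeval z (gaussianScale P.coeff d θ)‖ := by
    intro θ hθ hθ1
    have hdeg : (gaussianScale P.coeff d θ).natDegree = d :=
      natDegree_gaussianScale (hP d le_rfl) hθ.ne'
    have hlt : θ * t < t := by nlinarith
    have hsplits : (gaussianScale P.coeff d θ).Splits := by
      refine splits_of_coeff_mul_coeff_le (mul_pos hθ ht).le ?_ ?_ ?_ <;> rw [hdeg]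
      · intro k hk
        rw [coeff_gaussianScale _ _ _ hk]
        exact mul_ne_zero (hP k hk) (pow_ne_zero _ hθ.ne')
      · intro k hk
        rw [coeff_gaussianScale _ _ _ hk, coeff_gaussianScale _ _ _ (by omega : k ≤ d),
          coeff_gaussianScale _ _ _ (by omega : k + 1 ≤ d)]
        simp only [abs_mul, abs_pow, abs_of_pos hθ]
        calc |P.coeff k| * θ ^ k ^ 2 * (|P.coeff (k + 2)| * θ ^ (k + 2) ^ 2)
            = |P.coeff k| * |P.coeff (k + 2)| * (θ ^ 2 * (θ ^ (k + 1) ^ 2) ^ 2) := by ring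
          _ ≤ t ^ 2 * |P.coeff (k + 1)| ^ 2 * (θ ^ 2 * (θ ^ (k + 1) ^ 2) ^ 2) :=
            mul_le_mul_of_nonneg_right (hlc k hk) (by positivity)
          _ = (θ * t) ^ 2 * (|P.coeff (k + 1)| * θ ^ (k + 1) ^ 2) ^ 2 := by ring
      · intro j hj hjd
        exact (add_lt_add (thetaSum_lt (mul_pos hθ ht).le hlt hj)
          (thetaSum_lt (mul_pos hθ ht).le hlt (by omega))).trans_le (hS j hj hjd)
    have h := leadingCoeff_mul_abs_im_pow_le_norm_aeval hsplits z
    rwa [leadingCoeff, hdeg, coeff_gaussianScale _ _ _ le_rfl, abs_mul, abs_pow,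
      abs_of_pos hθ] at h
  have hcont : Continuous fun θ : ℝ =>
      ‖aeval z (gaussianScale P.coeff d θ)‖ - |P.coeff d| * θ ^ (d ^ 2) * |z.im| ^ d := by
    simp only [gaussianScale, map_sum, map_mul, map_pow, aeval_C, aeval_X]
    fun_prop
  have hlim := hcont.continuousWithinAt (s := Set.Ioo 0 1) (x := 1)
  have hmem : (1 : ℝ) ∈ closure (Set.Ioo (0 : ℝ) 1) := by
    rw [closure_Ioo zero_ne_one]; simp
  have hone : gaussianScale P.coeff d 1 = P := by
    simp only [gaussianScale, one_pow, mul_one]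
    exact (P.as_sum_range_C_mul_X_pow).symm
  have hfin : (0 : ℝ) ≤ ‖aeval z (gaussianScale P.coeff d 1)‖ -
      |P.coeff d| * 1 ^ (d ^ 2) * |z.im| ^ d := by
    have := mem_closure_iff_nhdsWithin_neBot.1 hmem
    refine ge_of_tendsto hlim ?_
    filter_upwards [self_mem_nhdsWithin] with θ hθ
    exact sub_nonneg.2 (hbound θ hθ.1 hθ.2)
  rw [hone, hz, norm_zero] at hfin
  have h1 : 0 < |P.coeff d| * 1 ^ (d ^ 2) * |z.im| ^ d := by
    have := abs_pos.2 (hP d le_rfl)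
    have := abs_pos.2 him
    positivity
  linarith

/-! ### Even degree and the theta root -/

theorem inv_sqrt_pow_sq {b : ℝ} (hb : 0 < b) (k : ℕ) :
    (√b)⁻¹ ^ (k ^ 2) = b ^ (-(k : ℝ) ^ 2 / 2) := by
  rw [Real.sqrt_eq_rpow, ← Real.rpow_neg hb.le, ← Real.rpow_natCast, ← Real.rpow_mul hb.le]
  congr 1
  push_cast
  ring

theorem bEven_pos {n : ℕ} (hn : 1 ≤ n) : 0 < bEven n := (bEven_spec n hn).1

theorem two_mul_thetaSum_bEven {n : ℕ} (hn : 1 ≤ n) : 2 * thetaSum (√(bEven n))⁻¹ n = 1 := by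
  have h := (bEven_spec n hn).2
  rw [← Finset.Ico_add_one_right_eq_Icc, Finset.sum_Ico_eq_sum_range, Nat.add_sub_cancel] at h
  have h2 : thetaSum (√(bEven n))⁻¹ n =
      ∑ k ∈ Finset.range n, bEven n ^ (-((1 + k : ℕ) : ℝ) ^ 2 / 2) :=
    Finset.sum_congr rfl fun k _ => by rw [inv_sqrt_pow_sq (bEven_pos hn), add_comm]
  linarith

theorem inv_sqrt_bEven_le_one {n : ℕ} (hn : 1 ≤ n) : (√(bEven n))⁻¹ ≤ 1 := by
  have h0 : 0 ≤ (√(bEven n))⁻¹ := by positivity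
  have h1 := thetaSum_mono h0 hn
  have h2 := two_mul_thetaSum_bEven hn
  have h3 : thetaSum (√(bEven n))⁻¹ 1 = (√(bEven n))⁻¹ := by simp [thetaSum]
  linarith

theorem mul_abs_coeff_le_of_le_abs_secondQuotient {P : ℝ[X]} {b : ℝ} {k : ℕ}
    (h0 : P.coeff k ≠ 0) (h2 : P.coeff (k + 2) ≠ 0) (h : b ≤ |secondQuotient P (k + 2)|) :
    b * (|P.coeff k| * |P.coeff (k + 2)|) ≤ |P.coeff (k + 1)| ^ 2 := by
  have hpos : 0 < |P.coeff k| * |P.coeff (k + 2)| := mul_pos (abs_pos.2 h0) (abs_pos.2 h2)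
  rw [secondQuotient, abs_div, abs_mul, abs_pow] at h
  exact (le_div_iff₀ hpos).1 h

/-- Allowing `d ≤ 2 * n` covers odd degrees too: missing terms only shorten the theta sums. -/
theorem allZerosReal_of_bEven_le {n d : ℕ} (hn : 1 ≤ n) (hd : d ≤ 2 * n) {P : ℝ[X]}
    (hP : HasDegreeAndNonzeroCoeffs P d)
    (hq : ∀ k ∈ Finset.Icc 2 d, bEven n ≤ |secondQuotient P k|) : AllZerosReal P := by
  obtain ⟨rfl, hP⟩ := hP
  have hb := bEven_pos hn
  refine allZerosReal_of_coeff_mul_coeff_le (inv_pos.2 (Real.sqrt_pos.2 hb)) hP ?_ ?_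
  · intro k hk
    have h := mul_abs_coeff_le_of_le_abs_secondQuotient (hP k (by omega)) (hP (k + 2) hk)
      (hq (k + 2) (by simp; omega))
    rw [inv_pow, Real.sq_sqrt hb.le, inv_mul_eq_div, le_div_iff₀ hb]
    linarith
  · intro j hj hjd
    have h0 : 0 ≤ (√(bEven n))⁻¹ := by positivity
    have h1 := thetaSum_add_thetaSum_le h0 (inv_sqrt_bEven_le_one hn) (by omega : j ≤ 2 * n)
    have h2 : thetaSum (√(bEven n))⁻¹ (P.natDegree - j) ≤ thetaSum (√(bEven n))⁻¹ (2 * n - j) :=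
      thetaSum_mono h0 (by omega)
    linarith [two_mul_thetaSum_bEven hn]

/-! ### Sharpness -/

theorem two_mul_le_add_of_mul_eq_sq {a b c : ℝ} (ha : 0 ≤ a) (hb : 0 ≤ b) (h : a * b = c ^ 2) :
    2 * c ≤ a + b :=
  le_of_sq_le_sq (by nlinarith [sq_nonneg (a - b)]) (by positivity)

/-- The signs of the extremal polynomials: only the coefficient of index `n` is positive. -/
noncomputable def peakSign (n k : ℕ) : ℝ := if k = n then 1 else -1

theorem abs_peakSign (n k : ℕ) : |peakSign n k| = 1 := by
  unfold peakSign
  split_ifs <;> simp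

theorem eval_gaussianScale_peakSign_neg {n d : ℕ} (hd : 2 * n ≤ d) {s x : ℝ}
    (hs : 0 < s) (hx : 0 < x) (hS : 1 < 2 * thetaSum s n) :
    (gaussianScale (peakSign n) d s).eval x < 0 := by
  set w : ℕ → ℝ := fun k => s ^ (k ^ 2) * x ^ k with hw
  have hwpos : ∀ k, 0 < w k := fun k => by positivity
  have heval : (gaussianScale (peakSign n) d s).eval x =
      w n - ∑ k ∈ (Finset.range (d + 1)).erase n, w k := by
    have h : (gaussianScale (peakSign n) d s).eval x =
        ∑ k ∈ Finset.range (d + 1), peakSign n k * w k := by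
      simp [gaussianScale, eval_finsetSum, hw, mul_assoc]
    rw [h, ← Finset.add_sum_erase _ _ (by simp; omega : n ∈ Finset.range (d + 1)),
      sub_eq_add_neg, ← Finset.sum_neg_distrib]
    congr 1
    · simp [peakSign]
    · exact Finset.sum_congr rfl fun k hk => by simp [peakSign, (Finset.mem_erase.1 hk).1]
  have hsub : ∑ k ∈ (Finset.range (2 * n + 1)).erase n, w k ≤
      ∑ k ∈ (Finset.range (d + 1)).erase n, w k :=
    Finset.sum_le_sum_of_subset_of_nonneg
      (Finset.erase_subset_erase _ (Finset.range_subset_range.2 (by omega)))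
      fun k _ _ => (hwpos k).le
  have hpair : 2 * thetaSum s n * w n ≤ ∑ k ∈ (Finset.range (2 * n + 1)).erase n, w k := by
    rw [sum_erase_range_eq w (by omega), show 2 * n - n = n by omega, ← Finset.sum_add_distrib,
      thetaSum, Finset.mul_sum, Finset.sum_mul]
    refine Finset.sum_le_sum fun m hm => ?_
    obtain ⟨i, hi⟩ : ∃ i, n = i + (m + 1) :=
      ⟨n - (m + 1), by have := Finset.mem_range.1 hm; omega⟩
    rw [mul_assoc]
    -- As `(n-m)² + (n+m)² = 2n² + 2m²`, the two terms at distance `m` from `n` have product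
    -- `(s^(m²) w_n)²`.
    refine two_mul_le_add_of_mul_eq_sq (hwpos _).le (hwpos _).le ?_
    rw [show n - (m + 1) = i by omega, hi]
    simp only [hw]
    ring
  rw [heval]
  nlinarith [hwpos n]

theorem abs_secondQuotient_gaussianScale {a : ℕ → ℝ} (ha : ∀ k, |a k| = 1) {d k : ℕ} {s : ℝ}
    (hs : 0 < s) (hk : k ∈ Finset.Icc 2 d) :
    |secondQuotient (gaussianScale a d s) k| = (s ^ 2)⁻¹ := by
  rw [Finset.mem_Icc] at hk
  obtain ⟨i, rfl⟩ : ∃ i, k = i + 2 := ⟨k - 2, by omega⟩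
  rw [secondQuotient, coeff_gaussianScale _ _ _ (by omega), coeff_gaussianScale _ _ _ (by omega),
    coeff_gaussianScale _ _ _ (by omega)]
  simp only [abs_div, abs_mul, abs_pow, ha, abs_of_pos hs, one_mul]
  rw [show i + 2 - 1 = i + 1 by omega, Nat.add_sub_cancel]
  field_simp
  ring

theorem exists_hasNonrealZero {n d : ℕ} (hn : 1 ≤ n) (hd : 2 * n ≤ d) {ε : ℝ} (hε : 0 < ε) :
    ∃ P : ℝ[X], HasDegreeAndNonzeroCoeffs P d ∧
      (∀ k ∈ Finset.Icc 2 d, bEven n - ε < |secondQuotient P k|) ∧ HasNonrealZero P := by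
  have hb := bEven_pos hn
  -- All `|q_k|` of the example will equal `β = s⁻²`.
  obtain ⟨β, hβ, hβb⟩ := exists_between (max_lt (sub_lt_self (bEven n) hε) hb)
  obtain ⟨hβε, hβ0⟩ := max_lt_iff.1 hβ
  set s := (√β)⁻¹ with hs_def
  have hs : 0 < s := inv_pos.2 (Real.sqrt_pos.2 hβ0)
  have hts : (√(bEven n))⁻¹ < s :=
    inv_strictAnti₀ (Real.sqrt_pos.2 hβ0) (Real.sqrt_lt_sqrt hβ0.le hβb)
  have hS : 1 < 2 * thetaSum s n := by
    have := thetaSum_lt (by positivity) hts hn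
    linarith [two_mul_thetaSum_bEven hn]
  have hne : ∀ k, peakSign n k ≠ 0 := fun k => abs_pos.1 (by rw [abs_peakSign]; exact one_pos)
  have hdeg : (gaussianScale (peakSign n) d s).natDegree = d :=
    natDegree_gaussianScale (hne d) hs.ne'
  refine ⟨gaussianScale (peakSign n) d s, ⟨hdeg, fun k hk => ?_⟩, fun k hk => ?_, ?_⟩
  · rw [coeff_gaussianScale _ _ _ hk]
    exact mul_ne_zero (hne k) (pow_ne_zero _ hs.ne')
  · rw [abs_secondQuotient_gaussianScale (abs_peakSign n) hs hk, hs_def, inv_pow,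
      Real.sq_sqrt hβ0.le, inv_inv]
    exact hβε
  · refine hasNonrealZero_of_forall_pos_eval_ne_zero (k := n)
      (fun x hx => (eval_gaussianScale_peakSign_neg hd hs hx hS).ne) ?_
    rw [leadingCoeff, hdeg, coeff_gaussianScale _ _ _ le_rfl,
      coeff_gaussianScale _ _ _ (by omega), peakSign, peakSign, if_neg (by omega), if_pos rfl]
    have h1 : 0 < s ^ (d ^ 2) := by positivity
    have h2 : 0 < s ^ (n ^ 2) := by positivity
    nlinarith [mul_pos h1 h2]

/-! ### Cubic polynomials -/

/-- The discriminant of a real polynomial of degree three. -/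
noncomputable def cubicDiscr (P : ℝ[X]) : ℝ :=
  (⟨P.coeff 3, P.coeff 2, P.coeff 1, P.coeff 0⟩ : Cubic ℝ).discr

theorem cubicDiscr_eq (P : ℝ[X]) : cubicDiscr P =
    P.coeff 2 ^ 2 * P.coeff 1 ^ 2 - 4 * P.coeff 3 * P.coeff 1 ^ 3 - 4 * P.coeff 2 ^ 3 * P.coeff 0 -
      27 * P.coeff 3 ^ 2 * P.coeff 0 ^ 2 + 18 * P.coeff 3 * P.coeff 2 * P.coeff 1 * P.coeff 0 :=
  rfl

theorem allZerosReal_of_cubicDiscr_nonneg {P : ℝ[X]} (hP : P.natDegree = 3)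
    (hD : 0 ≤ cubicDiscr P) : AllZerosReal P := by
  intro z hz
  by_contra him
  have h3 : P.coeff 3 ≠ 0 := by
    rw [← hP]
    exact leadingCoeff_ne_zero.2 fun h => by simp [h] at hP
  rw [aeval_eq_sum_range, hP] at hz
  rw [cubicDiscr_eq] at hD
  obtain ⟨x, y⟩ := z
  have hre := congrArg Complex.re hz
  have him' := congrArg Complex.im hz
  simp [Finset.sum_range_succ, pow_succ] at hre him' him
  generalize P.coeff 3 = a at h3 hD hre him'
  generalize P.coeff 2 = b at hD hre him'
  generalize P.coeff 1 = c at hD hre him'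
  generalize P.coeff 0 = e at hD hre
  have h1 : c = -(a * (3 * x ^ 2 - y ^ 2) + 2 * b * x) := by
    refine mul_right_cancel₀ him ?_
    linear_combination him'
  have h0 : e = -(a * (x ^ 3 - 3 * x * y ^ 2) + b * (x ^ 2 - y ^ 2) + c * x) := by
    linear_combination hre
  -- For zeros `x ± iy` and `r = -b/a - 2x`, this is `a⁴ (z - z̄)² |z - r|⁴`.
  have hneg : b ^ 2 * c ^ 2 - 4 * a * c ^ 3 - 4 * b ^ 3 * e - 27 * a ^ 2 * e ^ 2 +
      18 * a * b * c * e = -(4 * y ^ 2 * ((b + 3 * a * x) ^ 2 + (a * y) ^ 2) ^ 2) := by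
    rw [h0, h1]
    ring
  have : 0 < 4 * y ^ 2 * ((b + 3 * a * x) ^ 2 + (a * y) ^ 2) ^ 2 := by
    have h4 : 0 < (a * y) ^ 2 := by positivity
    have h5 : 0 < (b + 3 * a * x) ^ 2 + (a * y) ^ 2 := by positivity
    positivity
  linarith

theorem cubicDiscr_nonneg_of_allZerosReal {P : ℝ[X]} (hP : P.natDegree = 3)
    (h : AllZerosReal P) : 0 ≤ cubicDiscr P := by
  set T : Cubic ℝ := ⟨P.coeff 3, P.coeff 2, P.coeff 1, P.coeff 0⟩ with hT
  have h3 : P.coeff 3 ≠ 0 := by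
    rw [← hP]
    exact leadingCoeff_ne_zero.2 fun h => by simp [h] at hP
  have hTP : T.toPoly = P := by
    conv_rhs => rw [P.as_sum_range_C_mul_X_pow, hP]
    simp [Cubic.toPoly, hT, Finset.sum_range_succ]
    ring
  have hs : (T.toPoly.map (RingHom.id ℝ)).Splits := by
    rw [hTP, map_id]
    exact h.splits
  obtain ⟨x, y, z, hr⟩ := (Cubic.splits_iff_roots_eq_three (φ := RingHom.id ℝ) (P := T) h3).1 hs
  have := Cubic.discr_eq_prod_three_roots (φ := RingHom.id ℝ) (P := T) h3 hr
  rw [RingHom.id_apply] at this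
  rw [cubicDiscr, ← hT, this]
  positivity

theorem one_sub_four_mul_add_nonneg {t u v : ℝ} (ht : 0 ≤ t) (ht4 : 4 * t ≤ 1)
    (h : 18 * t ^ 2 + 27 * t ^ 4 = 1) (hu : |u| ≤ t) (hv : |v| ≤ t) :
    0 ≤ 1 - 4 * u - 4 * v + 18 * (u * v) - 27 * (u * v) ^ 2 := by
  have hmixed : ∀ x y : ℝ, 0 ≤ x → x ≤ t → 0 ≤ y → y ≤ t →
      0 ≤ 1 + 4 * x - 4 * y - 18 * (x * y) - 27 * (x * y) ^ 2 := by
    intro x y hx hxt hy hyt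
    have h1 : x * y ≤ x * t := mul_le_mul_of_nonneg_left hyt hx
    have h2 : (x * y) ^ 2 ≤ (x * t) ^ 2 := pow_le_pow_left₀ (by positivity) h1 2
    have h3 : 0 ≤ 1 + 4 * x - 4 * t - 18 * (x * t) - 27 * (x * t) ^ 2 := by
      have htpos : 0 < t := ht.lt_of_ne fun h0 => by simp [← h0] at h
      refine nonneg_of_mul_nonneg_right (b := 1 + 4 * x - 4 * t - 18 * (x * t) - 27 * (x * t) ^ 2)
        ?_ htpos
      have h4 := mul_nonneg (sub_nonneg.2 hxt) (sub_nonneg.2 ht4)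
      have h5 : 0 ≤ 27 * t ^ 3 * (x * (t - x)) :=
        mul_nonneg (by positivity) (mul_nonneg hx (sub_nonneg.2 hxt))
      -- At `y = t` the expression is concave in `x`, hence above its chord between `1 - 4t` at `x =
      -- 0` and `0` at `x = t`.
      linear_combination h4 + h5 + x * h
    linarith
  rw [abs_le] at hu hv
  rcases le_total 0 u with hu0 | hu0 <;> rcases le_total 0 v with hv0 | hv0
  -- Here the expression is `(1 - 4u)(1 - 4v) + uv(2 - 27uv)`, with `uv ≤ 1/16`.
  · have h1 : u * v ≤ t * t := mul_le_mul hu.2 hv.2 hv0 ht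
    have h2 : 0 ≤ u * v := mul_nonneg hu0 hv0
    have h3 : t * t ≤ 1 / 16 := by nlinarith
    have h4 := mul_nonneg h2 (by linarith : 0 ≤ 2 - 27 * (u * v))
    have h5 := mul_nonneg (by linarith : 0 ≤ 1 - 4 * u) (by linarith : 0 ≤ 1 - 4 * v)
    linarith
  · have := hmixed (-v) u (by linarith) (by linarith) hu0 hu.2
    nlinarith
  · have := hmixed (-u) v (by linarith) (by linarith) hv0 hv.2
    nlinarith
  · have h1 : (-u) * (-v) ≤ t * t := mul_le_mul (by linarith) (by linarith) (by linarith) ht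
    have h2 : 0 ≤ u * v := mul_nonneg_of_nonpos_of_nonpos hu0 hv0
    nlinarith

theorem sqrt_nine_add_pow_four :
    √(9 + 6 * √3) ^ 4 = 18 * √(9 + 6 * √3) ^ 2 + 27 := by
  have h3 : √3 ^ 2 = 3 := Real.sq_sqrt (by norm_num)
  have h : √(9 + 6 * √3) ^ 2 = 9 + 6 * √3 := Real.sq_sqrt (by positivity)
  rw [show √(9 + 6 * √3) ^ 4 = (√(9 + 6 * √3) ^ 2) ^ 2 by ring, h]
  linear_combination 36 * h3

theorem four_le_sqrt_nine_add : 4 ≤ √(9 + 6 * √3) := by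
  have h3 : (3 / 2 : ℝ) ≤ √3 := Real.le_sqrt_of_sq_le (by norm_num)
  exact Real.le_sqrt_of_sq_le (by linarith)

theorem allZerosReal_cubic {P : ℝ[X]} (hP : HasDegreeAndNonzeroCoeffs P 3)
    (hq : ∀ k ∈ Finset.Icc 2 3, √(9 + 6 * √3) ≤ |secondQuotient P k|) : AllZerosReal P := by
  obtain ⟨hdeg, hP⟩ := hP
  refine allZerosReal_of_cubicDiscr_nonneg hdeg ?_
  have h0 := hP 0 (by norm_num)
  have h1 := hP 1 (by norm_num)
  have h2 := hP 2 (by norm_num)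
  have h3 := hP 3 (by norm_num)
  have hc4 := four_le_sqrt_nine_add
  have hc := sqrt_nine_add_pow_four
  have e2 := inv_anti₀ (by linarith) (hq 2 (by simp))
  have e3 := inv_anti₀ (by linarith) (hq 3 (by simp))
  rw [← abs_inv, secondQuotient, inv_div] at e2 e3
  simp only [Nat.reduceSub] at e2 e3
  set c := √(9 + 6 * √3)
  have hcpos : 0 < c := by linarith
  have key := one_sub_four_mul_add_nonneg (t := c⁻¹) (by positivity)
    (by rw [← div_eq_mul_inv, div_le_one hcpos]; exact hc4)
    (by field_simp; linarith) e2 e3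
  have hfac : cubicDiscr P = (P.coeff 1 * P.coeff 2) ^ 2 *
      (1 - 4 * (P.coeff 0 * P.coeff 2 / P.coeff 1 ^ 2) -
        4 * (P.coeff 1 * P.coeff 3 / P.coeff 2 ^ 2) +
        18 * (P.coeff 0 * P.coeff 2 / P.coeff 1 ^ 2 * (P.coeff 1 * P.coeff 3 / P.coeff 2 ^ 2)) -
        27 * (P.coeff 0 * P.coeff 2 / P.coeff 1 ^ 2 *
          (P.coeff 1 * P.coeff 3 / P.coeff 2 ^ 2)) ^ 2) := by
    rw [cubicDiscr_eq]
    field_simp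
    ring
  rw [hfac]
  exact mul_nonneg (sq_nonneg _) key

theorem exists_cubic_hasNonrealZero {ε : ℝ} (hε : 0 < ε) :
    ∃ P : ℝ[X], HasDegreeAndNonzeroCoeffs P 3 ∧
      (∀ k ∈ Finset.Icc 2 3, √(9 + 6 * √3) - ε < |secondQuotient P k|) ∧ HasNonrealZero P := by
  have hc4 := four_le_sqrt_nine_add
  have hc := sqrt_nine_add_pow_four
  set c := √(9 + 6 * √3)
  obtain ⟨s, hs, hsc⟩ := exists_between (max_lt (sub_lt_self c hε) (by linarith : 0 < c))
  obtain ⟨hsε, hs0⟩ := max_lt_iff.1 hs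
  -- For `x³ - s x² + s x + 1` one has `q_2 = -s`, `q_3 = s`, the worst corner, and discriminant `s⁴
  -- - 18s² - 27`, negative for `s < c`.
  set T : Cubic ℝ := ⟨1, -s, s, 1⟩ with hT
  have hdeg : T.toPoly.natDegree = 3 := Cubic.natDegree_of_a_ne_zero one_ne_zero
  have c0 : T.toPoly.coeff 0 = 1 := Cubic.coeff_eq_d
  have c1 : T.toPoly.coeff 1 = s := Cubic.coeff_eq_c
  have c2 : T.toPoly.coeff 2 = -s := Cubic.coeff_eq_b
  have c3 : T.toPoly.coeff 3 = 1 := Cubic.coeff_eq_a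
  refine ⟨T.toPoly, ⟨hdeg, fun k hk => ?_⟩, fun k hk => ?_, ?_⟩
  · interval_cases k <;> simp [c0, c1, c2, c3, hs0.ne']
  · have : |secondQuotient T.toPoly k| = s := by
      rw [Finset.mem_Icc] at hk
      obtain ⟨hk2, hk3⟩ := hk
      interval_cases k <;>
        simp [secondQuotient, c0, c1, c2, c3, abs_div, abs_of_pos hs0, pow_two, hs0.ne']
    rwa [this]
  · refine hasNonrealZero_of_not_allZerosReal fun h => ?_
    have hD := cubicDiscr_nonneg_of_allZerosReal hdeg h
    rw [cubicDiscr_eq, c0, c1, c2, c3] at hD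
    have h1 : s ^ 2 < c ^ 2 := pow_lt_pow_left₀ hsc hs0.le (by norm_num)
    have h2 : 18 < c ^ 2 := by nlinarith
    nlinarith [mul_pos (sub_pos.2 h1) (by linarith [sq_nonneg s] : 0 < c ^ 2 + s ^ 2 - 18)]

theorem theorem4 :
    -- degree `2n`
    (∀ n : ℕ, 1 ≤ n → ∀ P : ℝ[X], HasDegreeAndNonzeroCoeffs P (2 * n) →
      (∀ k ∈ Finset.Icc 2 (2 * n), bEven n ≤ |secondQuotient P k|) → AllZerosReal P) ∧
    (∀ n : ℕ, 1 ≤ n → ∀ ε : ℝ, 0 < ε → ∃ P : ℝ[X], HasDegreeAndNonzeroCoeffs P (2 * n) ∧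
      (∀ k ∈ Finset.Icc 2 (2 * n), bEven n - ε < |secondQuotient P k|) ∧ HasNonrealZero P) ∧
    -- degree `2n + 1`; here `bEven (n + 1)` is `b_{2n+2}`
    (∀ n : ℕ, 1 ≤ n → ∀ P : ℝ[X], HasDegreeAndNonzeroCoeffs P (2 * n + 1) →
      (∀ k ∈ Finset.Icc 2 (2 * n + 1), bEven (n + 1) ≤ |secondQuotient P k|) →
        AllZerosReal P) ∧
    (∀ n : ℕ, 1 ≤ n → ∀ ε : ℝ, 0 < ε → ∃ P : ℝ[X], HasDegreeAndNonzeroCoeffs P (2 * n + 1) ∧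
      (∀ k ∈ Finset.Icc 2 (2 * n + 1), bEven n - ε < |secondQuotient P k|) ∧
        HasNonrealZero P) ∧
    -- degree `3`
    (∀ P : ℝ[X], HasDegreeAndNonzeroCoeffs P 3 →
      (∀ k ∈ Finset.Icc 2 3, √(9 + 6 * √3) ≤ |secondQuotient P k|) → AllZerosReal P) ∧
    (∀ ε : ℝ, 0 < ε → ∃ P : ℝ[X], HasDegreeAndNonzeroCoeffs P 3 ∧
      (∀ k ∈ Finset.Icc 2 3, √(9 + 6 * √3) - ε < |secondQuotient P k|) ∧
        HasNonrealZero P) := by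
  refine ⟨fun n hn P hP hq => allZerosReal_of_bEven_le hn le_rfl hP hq,
    fun n hn ε hε => exists_hasNonrealZero hn le_rfl hε,
    fun n _ P hP hq => allZerosReal_of_bEven_le (by omega) (by omega) hP hq,
    fun n hn ε hε => exists_hasNonrealZero hn (by omega) hε,
    fun P hP hq => allZerosReal_cubic hP hq,
    fun ε hε => exists_cubic_hasNonrealZero hε⟩
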